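/- Let $1\le N<K$, let $\mathcal G_1\subset\{1,\dots,K\}$ with $|\mathcal G_1|=N$, and let $0<v_k\le 1$ for $k=1,\dots,K$. Let the channels $\mathbf h_1,\dots,\mathbf h_K\in\mathbb C^N$ have i.i.d. $\mathcal{CN}(0,1)$ entries, let $\mathbf p_c$ be a random unit vector (the common precoder, which may depend on the channels), and let $\mathbf p_j$, $j\in\mathcal G_1$, be zero-forcing private precoders: random unit vectors with $\mathbf h_j^H\mathbf p_k=0$ almost surely for all distinct $j,k\in\mathcal G_1$. For total power $P$ and private power fraction $t$, the ergodic rate of the common stream is $$R_c^{\mathrm{ZF}}(t)=\mathbb E\,\log_2\Bigl(1+\min_{1\le k\le K}\frac{P(1-t)\,v_k\,|\mathbf h_k^H\mathbf p_c|^2}{1+\frac{Pt}{N}\,v_k\sum_{j\in\mathcal G_1}|\mathbf h_k^H\mathbf p_j|^2}\Bigr).$$ Let $\widetilde R_c^{\mathrm{ZF}}(t)$ be the approximation obtained by replacing the gains $|\mathbf h_k^H\mathbf p_c|^2$ and $|\mathbf h_k^H\mathbf p_j|^2$ ($1\le k\le K$, $j\in\mathcal G_1$) in this expression by mutually independent random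 variables $A_k$ and $B_{kj}$, where $B_{kj}$ has the distribution of $|\mathbf h_k^H\mathbf p_j|^2$, and $A_k$ has the distribution of $|\mathbf x^H\mathbf u|^2$ with $\mathbf x$ distributed as $\mathbf h_k$ and $\mathbf u$ distributed as $\mathbf p_c$, independent of each other. Then there is $s_0>0$ such that for all real $P$ and all $t\in(0,1]$ with $Pt\ge s_0$ the expectation defining $\widetilde R_c^{\mathrm{ZF}}(t)$ is finite and $$\widetilde R_c^{\mathrm{ZF}}(t)\ \ge\ \log_2\Bigl(1-\rho^{\mathrm{ZF}}+\frac{\rho^{\mathrm{ZF}}}{t}\Bigr),\qquad \rho^{\mathrm{ZF}}=\frac{N}{\lfloor N(K-N+1)\rceil-1}\,e^{-\gamma-\frac{1}{2(\lfloor N(K-N+1)\rceil-1)}},$$ where $\lfloor\cdot\rceil$ denotes rounding to the nearest integer and $\gamma$ is the Euler–Mascheroni constant. -/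

import Mathlib

open MeasureTheory ProbabilityTheory

/-- The circularly symmetric complex Gaussian law `CN(0,1)`: real and imaginary parts are
independent real Gaussians of mean `0` and variance `1/2`. -/
noncomputable def complexGaussian : Measure ℂ :=
  ((gaussianReal 0 (1 / 2)).prod (gaussianReal 0 (1 / 2))).map
    Complex.measurableEquivRealProd.symm

/-- Rayleigh fading: the channel vectors `h 1, …, h K` in `ℂ^N` have i.i.d. `CN(0,1)` entries. -/
structure IsRayleighChannel {N K : ℕ} {Ω : Type*} [MeasurableSpace Ω]
    (h : Fin K → Ω → EuclideanSpace ℂ (Fin N)) (μ : Measure Ω) : Prop where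
  hasLaw : ∀ k i, HasLaw (fun ω => h k ω i) complexGaussian μ
  indep : iIndepFun (fun (q : Fin K × Fin N) ω => h q.1 ω q.2) μ

/-- A random unit vector (a normalised precoder); it may depend on the channels in any way. -/
structure IsPrecoder {N : ℕ} {Ω : Type*} [MeasurableSpace Ω]
    (p : Ω → EuclideanSpace ℂ (Fin N)) (μ : Measure Ω) : Prop where
  aemeasurable : AEMeasurable p μ
  norm_eq_one : ∀ᵐ ω ∂μ, ‖p ω‖ = 1

/-- Zero-forcing private precoders for the users of the group `G₁`: normalised, and
`h_jᴴ p_k = 0` for all distinct `j, k` in `G₁`. -/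
structure IsZFPrecoder {N K : ℕ} {Ω : Type*} [MeasurableSpace Ω] (G₁ : Finset (Fin K))
    (h : Fin K → Ω → EuclideanSpace ℂ (Fin N)) (p : G₁ → Ω → EuclideanSpace ℂ (Fin N))
    (μ : Measure Ω) : Prop where
  isPrecoder : ∀ k, IsPrecoder (p k) μ
  zero_forcing : ∀ᵐ ω ∂μ, ∀ j k : G₁, j ≠ k → inner ℂ (h j ω) (p k ω) = 0

/-- The power gain `|xᴴ u|²` of the direction `u` over the channel `x`. -/
noncomputable def gain {N : ℕ} (x u : EuclideanSpace ℂ (Fin N)) : ℝ := ‖inner ℂ x u‖ ^ 2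

/-- The common-stream SINR of user `k` as a function of the gains: `a k` is the gain `|h_kᴴ p_c|²`
of the common precoder and `b k j` the gain `|h_kᴴ p_j|²` of the private precoder of `j ∈ G₁`. The
private power `P t` is shared equally by the `N` users of `G₁`. -/
noncomputable def commonSINR {K : ℕ} (N : ℕ) (G₁ : Finset (Fin K)) (v : Fin K → ℝ) (P t : ℝ)
    (a : Fin K → ℝ) (b : Fin K → G₁ → ℝ) (k : Fin K) : ℝ :=
  P * (1 - t) * v k * a k / (1 + P * t / N * v k * ∑ j, b k j)

/-- The common-stream rate `log₂ (1 + min_k SINR_k)` for given gains. -/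
noncomputable def commonRate {K : ℕ} (N : ℕ) (G₁ : Finset (Fin K)) (v : Fin K → ℝ) (P t : ℝ)
    (g : (Fin K → ℝ) × (Fin K → G₁ → ℝ)) : ℝ :=
  Real.logb 2 (1 + ⨅ k, commonSINR N G₁ v P t g.1 g.2 k)

/-- The exact ergodic common-stream rate `R_c(t)`: the expectation under the true joint law of the
gains. -/
noncomputable def ergodicCommonRate {N K : ℕ} {Ω : Type*} [MeasurableSpace Ω]
    (G₁ : Finset (Fin K)) (v : Fin K → ℝ) (P t : ℝ) (h : Fin K → Ω → EuclideanSpace ℂ (Fin N))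
    (pc : Ω → EuclideanSpace ℂ (Fin N)) (p : G₁ → Ω → EuclideanSpace ℂ (Fin N))
    (μ : Measure Ω) : ℝ :=
  ∫ ω, commonRate N G₁ v P t
    (fun k => gain (h k ω) (pc ω), fun k j => gain (h k ω) (p j ω)) ∂μ

/-- The law of the gains in the independence approximation. All gains are mutually independent; the
common gain of user `k` is distributed as `|xᴴ u|²` with `x ∼ h k` and `u ∼ pc` independent; each
private gain has its true distribution. -/
noncomputable def approxGainLaw {N K : ℕ} {Ω : Type*} [MeasurableSpace Ω]
    (G₁ : Finset (Fin K)) (h : Fin K → Ω → EuclideanSpace ℂ (Fin N))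
    (pc : Ω → EuclideanSpace ℂ (Fin N)) (p : G₁ → Ω → EuclideanSpace ℂ (Fin N))
    (μ : Measure Ω) : Measure ((Fin K → ℝ) × (Fin K → G₁ → ℝ)) :=
  (Measure.pi fun k => ((μ.map (h k)).prod (μ.map pc)).map fun z => gain z.1 z.2).prod
    (Measure.pi fun k => Measure.pi fun j => μ.map fun ω => gain (h k ω) (p j ω))

/-- The approximation to the ergodic common-stream rate: the expectation of the same rate under the
independence approximation of the law of the gains. -/
noncomputable def approxCommonRate {N K : ℕ} {Ω : Type*} [MeasurableSpace Ω]
    (G₁ : Finset (Fin K)) (v : Fin K → ℝ) (P t : ℝ) (h : Fin K → Ω → EuclideanSpace ℂ (Fin N))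
    (pc : Ω → EuclideanSpace ℂ (Fin N)) (p : G₁ → Ω → EuclideanSpace ℂ (Fin N))
    (μ : Measure Ω) : ℝ :=
  ∫ g, commonRate N G₁ v P t g ∂(approxGainLaw G₁ h pc p μ)

/-- The constant `N / (M - 1) * exp (-γ - 1 / (2 (M - 1)))` with `M = ⌊N (K - N + 1)⌉`
(nearest integer) and `γ` the Euler–Mascheroni constant. -/
noncomputable def rhoZF (N K : ℕ) : ℝ :=
  (N : ℝ) / ((round ((N : ℝ) * ((K : ℝ) - N + 1)) : ℝ) - 1) *
    Real.exp (-Real.eulerMascheroniConstant -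
      1 / (2 * ((round ((N : ℝ) * ((K : ℝ) - N + 1)) : ℝ) - 1)))

/-! Under the independence approximation every gain has an explicit law. A fixed or independent
direction sees a Gaussian channel with an exponential gain of mean one. A zero-forcing vector is
almost surely determined, up to a phase, by the channels of the other users of `G₁`. Its gain is
therefore exponential for its own user and for every user outside `G₁`, and zero for the rest
(`approxGainLaw_eq_gainLaw`).

Dividing each SINR by `c = N (1 - t) / t` turns the rate into `log (1 + c Y)`, up to the factor `log
2`, with `Y = min_k A_k / (d_k + ∑ j, B_kj)` and `d_k = N / (P t v_k)`. Exponential tails and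
Laplace transforms give the survival function `exp (-ε y) (1 + y) ^ (-M)`, where `ε = ∑ d_k` and `M
= N (K - N + 1)` (`gainLaw_lt_normalizedMinSINR`).

Since `x ↦ log (1 + c exp x)` is convex, Jensen suggests `E log (1 + c Y) ≥ log (1 + c exp (E log
Y))`. Without noise (`ε = 0`), `E log Y = -H_{M-1}`; noise lowers this by at most `ε / (M - 1)`. The
bound `H_m < γ + log m + 1 / (2 m)` is strict, so `-H_{M-1}` exceeds `log (ρ / N)` by some `δ > 0`
that does not depend on `P` and `t`. As `ε` is inversely proportional to `P t`, this slack absorbs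
the noise once `P t` is large (`log_le_integral_rate_survival`, `harmonic_succ_lt`). -/

/-! ### Harmonic numbers and the Euler–Mascheroni constant. -/

theorem Real.log_lt_half_sub_inv {x : ℝ} (hx : 1 < x) : Real.log x < (x - x⁻¹) / 2 := by
  rw [← Real.sinh_log (by linarith)]
  exact Real.self_lt_sinh_iff.2 (Real.log_pos hx)

/-- The second-order upper bound for the harmonic numbers. -/
theorem harmonic_succ_lt (n : ℕ) :
    (harmonic (n + 1) : ℝ) <
      Real.eulerMascheroniConstant + Real.log (n + 1) + 1 / (2 * (n + 1)) := by
  let a : ℕ → ℝ := fun n => harmonic (n + 1) - Real.log (n + 1 : ℕ) - 1 / (2 * (n + 1))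
  -- The trapezoidal rule overestimates the integral of the convex function `1 / x` over `[k + 1, k
  -- + 2]`; this is the logarithm bound at `x = (k + 2) / (k + 1)`.
  have hmono : StrictMono a := by
    refine strictMono_nat_of_lt_succ fun k => ?_
    have hk : (0 : ℝ) < k + 1 := by positivity
    have hk2 : (0 : ℝ) < k + 2 := by positivity
    have h1 : (1 : ℝ) < (k + 2) / (k + 1) := by rw [lt_div_iff₀ hk]; linarith
    have h2 := Real.log_lt_half_sub_inv h1
    rw [Real.log_div hk2.ne' hk.ne'] at h2
    have h3 : (((k : ℝ) + 2) / (k + 1) - (((k : ℝ) + 2) / (k + 1))⁻¹) / 2 =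
        1 / (k + 2) + 1 / (2 * (k + 1)) - 1 / (2 * (k + 2)) := by field_simp; ring
    rw [h3] at h2
    simp only [a]
    rw [harmonic_succ (k + 1)]
    push_cast
    have e1 : (k : ℝ) + 1 + 1 = k + 2 := by ring
    rw [e1, ← one_div]
    linarith
  have hlim : Filter.Tendsto a Filter.atTop (nhds Real.eulerMascheroniConstant) := by
    have h1 := (Filter.tendsto_add_atTop_iff_nat 1).2 Real.tendsto_harmonic_sub_log
    have h2 : Filter.Tendsto (fun n : ℕ => (1 / 2 : ℝ) * (1 / ((n : ℝ) + 1))) Filter.atTop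
        (nhds ((1 / 2) * 0)) := tendsto_one_div_add_atTop_nhds_zero_nat.const_mul _
    have h3 := h1.sub h2
    simp only [mul_zero, sub_zero] at h3
    refine h3.congr fun k => ?_
    simp only [a]
    congr 1
    field_simp
  -- Going through the term `n + 1` keeps the inequality strict in the limit.
  have h := (hmono (Nat.lt_succ_self n)).trans_le (hmono.monotone.ge_of_tendsto hlim _)
  simp only [a] at h
  push_cast at h
  linarith

/-! ### The Jensen-type bound as an inequality between integrals of survival functions. -/

section Integrals

open Set Filter Topology

theorem hasDerivAt_inv_one_add_pow (n : ℕ) {y : ℝ} (hy : 0 ≤ y) :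
    HasDerivAt (fun y : ℝ => -(1 / ((n : ℝ) + 1)) * ((1 + y) ^ (n + 1))⁻¹)
      ((1 + y) ^ (n + 2))⁻¹ y := by
  have hy' : (1 + y) ≠ 0 := by positivity
  have h := (((hasDerivAt_id y).const_add 1).fun_pow (n + 1)).inv (pow_ne_zero _ hy')
  have h' := h.const_mul (-(1 / ((n : ℝ) + 1)))
  convert! h' using 1
  simp only [Nat.add_sub_cancel, id]
  push_cast
  field_simp
  ring

theorem tendsto_inv_one_add_pow (n : ℕ) :
    Tendsto (fun y : ℝ => -(1 / ((n : ℝ) + 1)) * ((1 + y) ^ (n + 1))⁻¹) atTop (𝓝 0) := by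
  have h : Tendsto (fun y : ℝ => ((1 + y) ^ (n + 1))⁻¹) atTop (𝓝 0) :=
    ((tendsto_pow_atTop n.succ_ne_zero).comp (tendsto_atTop_add_const_left _ 1 tendsto_id)).inv_tendsto_atTop
  simpa using h.const_mul (-(1 / ((n : ℝ) + 1)))

theorem integrableOn_inv_one_add_pow (n : ℕ) :
    IntegrableOn (fun y : ℝ => ((1 + y) ^ (n + 2))⁻¹) (Ioi 0) :=
  integrableOn_Ioi_deriv_of_nonneg' (fun _ hy => hasDerivAt_inv_one_add_pow n hy)
    (fun y hy => by have : 0 < y := hy; positivity) (tendsto_inv_one_add_pow n)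

theorem integral_inv_one_add_pow (n : ℕ) :
    ∫ y in Ioi (0 : ℝ), ((1 + y) ^ (n + 2))⁻¹ = 1 / (n + 1) := by
  rw [integral_Ioi_of_hasDerivAt_of_nonneg' (fun _ hy => hasDerivAt_inv_one_add_pow n hy)
    (fun y hy => by have : 0 < y := hy; positivity) (tendsto_inv_one_add_pow n)]
  simp

/-- The kernel `((1 + y)⁻¹ - 1_{y ≤ r}) / y`, whose integral over the half line is `-log r`. -/
noncomputable def lomaxKernel (r y : ℝ) : ℝ :=
  if y ≤ r then -(1 + y)⁻¹ else y⁻¹ - (1 + y)⁻¹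

/-- The subtraction removes the singularity of `1 / y` at zero and its tail at infinity. The
antiderivatives `-log (1 + y)` and `-log (1 + y⁻¹)` contribute `-log (1 + r)` and `log (1 + r⁻¹)`.
-/
theorem lomaxKernel_integral {r : ℝ} (hr : 0 < r) :
    IntegrableOn (lomaxKernel r) (Ioi 0) ∧ ∫ y in Ioi 0, lomaxKernel r y = -Real.log r := by
  have hsplit : Ioc 0 r ∪ Ioi r = Ioi (0 : ℝ) := Ioc_union_Ioi_eq_Ioi hr.le
  have e1 : EqOn (fun y => -(1 + y)⁻¹) (lomaxKernel r) (Ioc 0 r) := fun y hy => by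
    simp [lomaxKernel, hy.2]
  have e2 : EqOn (fun y => y⁻¹ - (1 + y)⁻¹) (lomaxKernel r) (Ioi r) := fun y hy => by
    simp [lomaxKernel, not_le.2 (show r < y from hy)]
  have d1 : ∀ y ∈ uIcc 0 r, HasDerivAt (fun y : ℝ => -Real.log (1 + y)) (-(1 + y)⁻¹) y := by
    intro y hy
    rw [uIcc_of_le hr.le] at hy
    have : (1 + y) ≠ 0 := by have := hy.1; positivity
    have h := (((hasDerivAt_id y).const_add 1).log this).neg
    convert! h using 1
    simp
  have c1 : ContinuousOn (fun y : ℝ => -(1 + y)⁻¹) (uIcc 0 r) := by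
    rw [uIcc_of_le hr.le]
    refine (ContinuousOn.inv₀ (by fun_prop) fun y hy => ?_).neg
    have := hy.1; positivity
  have i1 : IntegrableOn (lomaxKernel r) (Ioc 0 r) :=
    ((intervalIntegrable_iff_integrableOn_Ioc_of_le hr.le).1 c1.intervalIntegrable).congr_fun e1
      measurableSet_Ioc
  have v1 : ∫ y in Ioc 0 r, lomaxKernel r y = -Real.log (1 + r) := by
    rw [← setIntegral_congr_fun measurableSet_Ioc e1, ← intervalIntegral.integral_of_le hr.le,
      intervalIntegral.integral_eq_sub_of_hasDerivAt d1 c1.intervalIntegrable]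
    simp
  have d2 : ∀ y ∈ Ici r, HasDerivAt (fun y : ℝ => -Real.log (1 + y⁻¹)) (y⁻¹ - (1 + y)⁻¹) y := by
    intro y hy
    have hy0 : 0 < y := hr.trans_le hy
    have h1 : (1 + y⁻¹) ≠ 0 := by positivity
    convert! (((hasDerivAt_inv hy0.ne').const_add 1).log h1).neg using 1
    field_simp
    ring
  have n2 : ∀ y ∈ Ioi r, (0 : ℝ) ≤ y⁻¹ - (1 + y)⁻¹ := by
    intro y hy
    have hy0 : 0 < y := hr.trans hy
    rw [sub_nonneg]
    exact inv_anti₀ hy0 (by linarith)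
  have t2 : Tendsto (fun y : ℝ => -Real.log (1 + y⁻¹)) atTop (𝓝 0) := by
    have h : Tendsto (fun y : ℝ => 1 + y⁻¹) atTop (𝓝 (1 + 0)) :=
      tendsto_inv_atTop_zero.const_add 1
    simpa using (h.log (by norm_num)).neg
  have i2 : IntegrableOn (lomaxKernel r) (Ioi r) :=
    (integrableOn_Ioi_deriv_of_nonneg' d2 n2 t2).congr_fun e2 measurableSet_Ioi
  have v2 : ∫ y in Ioi r, lomaxKernel r y = Real.log (1 + r⁻¹) := by
    rw [← setIntegral_congr_fun measurableSet_Ioi e2,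
      integral_Ioi_of_hasDerivAt_of_nonneg' d2 n2 t2]
    simp
  rw [← hsplit]
  refine ⟨i1.union i2, ?_⟩
  rw [setIntegral_union (Ioc_disjoint_Ioi le_rfl) measurableSet_Ioi
    i1 i2, v1, v2]
  have : 1 + r⁻¹ = (1 + r) / r := by field_simp; ring
  rw [this, Real.log_div (by positivity) hr.ne']
  ring

/-- A geometric sum that lowers the exponent of the survival function to one. After division by `y`,
the summand `j` integrates to `1 / (j + 1)`, which is the source of the harmonic number. -/
theorem sum_mul_inv_one_add_pow (n : ℕ) {y : ℝ} (hy : 0 < y) :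
    ∑ j ∈ Finset.range n, y * ((1 + y) ^ (j + 2))⁻¹ = (1 + y)⁻¹ - ((1 + y) ^ (n + 1))⁻¹ := by
  induction n with
  | zero => simp
  | succ n ih =>
    rw [Finset.sum_range_succ, ih]
    have : 1 + y ≠ 0 := by positivity
    field_simp
    ring

/-- An integrable minorant of `(G y - 1_{y ≤ r}) / y`, where
`G y = exp (-ε y) (1 + y) ^ (-(n + 2))`. -/
noncomputable def survivalMinorant (n : ℕ) (ε r y : ℝ) : ℝ :=
  lomaxKernel r y - ∑ j ∈ Finset.range (n + 1), ((1 + y) ^ (j + 2))⁻¹ -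
    ε * ((1 + y) ^ (n + 2))⁻¹

theorem survivalMinorant_integral (n : ℕ) (ε : ℝ) {r : ℝ} (hr : 0 < r) :
    IntegrableOn (survivalMinorant n ε r) (Ioi 0) ∧
      ∫ y in Ioi 0, survivalMinorant n ε r y =
        -Real.log r - harmonic (n + 1) - ε / (n + 1) := by
  obtain ⟨h1, h2⟩ := lomaxKernel_integral hr
  have h3 : IntegrableOn (fun y : ℝ => ∑ j ∈ Finset.range (n + 1), ((1 + y) ^ (j + 2))⁻¹)
      (Ioi 0) := integrable_finsetSum _ fun j _ => integrableOn_inv_one_add_pow j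
  have h4 : IntegrableOn (fun y : ℝ => ε * ((1 + y) ^ (n + 2))⁻¹) (Ioi 0) :=
    (integrableOn_inv_one_add_pow n).const_mul ε
  refine ⟨(h1.sub h3).sub h4, ?_⟩
  unfold survivalMinorant
  rw [integral_sub (f := fun y => lomaxKernel r y - _) (h1.sub h3) h4, integral_sub h1 h3, h2,
    integral_finsetSum _ fun j _ => integrableOn_inv_one_add_pow j, integral_const_mul]
  simp_rw [integral_inv_one_add_pow]
  simp [harmonic, div_eq_mul_inv]

/-- The only loss is `exp (-ε y) ≥ 1 - ε y`, so equality holds at `ε = 0`. The integral of the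
minorant is thus a lower bound for `E log Y - log r`. -/
theorem mul_survivalMinorant_le (n : ℕ) (ε r : ℝ) {y : ℝ} (hy : 0 < y) :
    y * survivalMinorant n ε r y ≤
      Real.exp (-(ε * y)) * ((1 + y) ^ (n + 2))⁻¹ - if y ≤ r then 1 else 0 := by
  have h1 : y * lomaxKernel r y = (1 + y)⁻¹ - if y ≤ r then 1 else 0 := by
    have : 1 + y ≠ 0 := by positivity
    unfold lomaxKernel
    split_ifs <;> field_simp <;> ring
  have h2 : y * survivalMinorant n ε r y =
      ((1 + y) ^ (n + 2))⁻¹ - (if y ≤ r then 1 else 0) - ε * y * ((1 + y) ^ (n + 2))⁻¹ := by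
    rw [survivalMinorant, mul_sub, mul_sub, h1, Finset.mul_sum, sum_mul_inv_one_add_pow _ hy]
    ring
  rw [h2]
  have h3 := mul_le_mul_of_nonneg_right (Real.add_one_le_exp (-(ε * y)))
    (show 0 ≤ ((1 + y) ^ (n + 2))⁻¹ by positivity)
  linarith

theorem integrableOn_rate_survival (n : ℕ) {ε c : ℝ} (hε : 0 ≤ ε) (hc : 0 ≤ c) :
    IntegrableOn (fun y : ℝ => c / (1 + c * y) * (Real.exp (-(ε * y)) * ((1 + y) ^ (n + 2))⁻¹))
      (Ioi 0) := by
  refine Integrable.mono' ((integrableOn_inv_one_add_pow n).const_mul c) ?_ ?_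
  · exact (by fun_prop : Measurable _).aestronglyMeasurable
  · refine (ae_restrict_iff' measurableSet_Ioi).2 (Eventually.of_forall fun y hy => ?_)
    have hy0 : 0 < y := hy
    rw [Real.norm_of_nonneg (by positivity)]
    have h1 : c / (1 + c * y) ≤ c := div_le_self hc (by nlinarith [mul_nonneg hc hy0.le])
    have h2 : Real.exp (-(ε * y)) ≤ 1 := Real.exp_le_one_iff.2 (by nlinarith [mul_nonneg hε hy0.le])
    have h3 : (0 : ℝ) ≤ ((1 + y) ^ (n + 2))⁻¹ := by positivity
    exact mul_le_mul h1 (mul_le_of_le_one_left h3 h2) (by positivity) hc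

theorem integral_rate_kernel {c : ℝ} (hc : 0 ≤ c) {x : ℝ} (hx : 0 ≤ x) :
    ∫ y in (0 : ℝ)..x, c / (1 + c * y) = Real.log (1 + c * x) := by
  have hpos : ∀ y ∈ uIcc 0 x, 1 + c * y ≠ 0 := fun y hy => by
    rw [uIcc_of_le hx] at hy
    have := hy.1
    positivity
  have hcont : ContinuousOn (fun y => c / (1 + c * y)) (uIcc 0 x) :=
    ContinuousOn.div (by fun_prop) (by fun_prop) hpos
  rw [intervalIntegral.integral_eq_sub_of_hasDerivAt
    (f := fun y => Real.log (1 + c * y))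
    (fun y hy => by
      simpa using (((hasDerivAt_id y).const_mul c).const_add 1).log (hpos y hy))
    hcont.intervalIntegrable]
  simp

/-- Jensen's inequality for `log (1 + c exp x)`, carried out as a single-crossing argument on
survival functions, so that integrability of `log Y` is never needed. -/
theorem log_le_integral_rate_survival (n : ℕ) {ε r c : ℝ} (hε : 0 ≤ ε) (hr : 0 < r) (hc : 0 ≤ c)
    (h : Real.log r + harmonic (n + 1) + ε / (n + 1) ≤ 0) :
    Real.log (1 + c * r) ≤
      ∫ y in Ioi 0, c / (1 + c * y) * (Real.exp (-(ε * y)) * ((1 + y) ^ (n + 2))⁻¹) := by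
  have hG := integrableOn_rate_survival n hε hc
  obtain ⟨hm, hmi⟩ := survivalMinorant_integral n ε hr
  set k : ℝ → ℝ := fun y => c / (1 + c * y)
  have hkint : IntegrableOn k (Ioc 0 r) := by
    refine (intervalIntegrable_iff_integrableOn_Ioc_of_le hr.le).1 (ContinuousOn.intervalIntegrable ?_)
    refine ContinuousOn.div (by fun_prop) (by fun_prop) fun y hy => ?_
    rw [uIcc_of_le hr.le] at hy
    have := hy.1
    positivity
  have hI : Integrable ((Ioc 0 r).indicator k) := hkint.integrable_indicator measurableSet_Ioc
  have hlog : Real.log (1 + c * r) = ∫ y in Ioi 0, (Ioc 0 r).indicator k y := by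
    rw [setIntegral_indicator measurableSet_Ioc,
      inter_eq_self_of_subset_right (Ioc_subset_Ioi_self),
      ← intervalIntegral.integral_of_le hr.le, integral_rate_kernel hc hr.le]
  -- The difference `G - 1_{y ≤ r}` is nonpositive up to `r` and nonnegative beyond, while the
  -- weight `c y / (1 + c y)` against `(G - 1_{y ≤ r}) / y` is nondecreasing. Freezing the weight at
  -- its value for `y = r` can only lower the integrand.
  have hle : ∫ y in Ioi 0, c * r / (1 + c * r) * survivalMinorant n ε r y ≤
      ∫ y in Ioi 0, (k y * (Real.exp (-(ε * y)) * ((1 + y) ^ (n + 2))⁻¹) -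
        (Ioc 0 r).indicator k y) := by
    refine setIntegral_mono_on (hm.const_mul _) (hG.sub hI.integrableOn) measurableSet_Ioi ?_
    intro y hy
    have hy0 : 0 < y := hy
    have hkey := mul_survivalMinorant_le n ε r hy0
    set G := Real.exp (-(ε * y)) * ((1 + y) ^ (n + 2))⁻¹
    have hG0 : 0 ≤ G := by positivity
    have hG1 : G ≤ 1 := mul_le_one₀
      (Real.exp_le_one_iff.2 (by nlinarith [mul_nonneg hε hy0.le])) (by positivity)
      (inv_le_one_of_one_le₀ (one_le_pow₀ (by linarith)))
    have e : k y * G - (Ioc 0 r).indicator k y = k y * (G - if y ≤ r then 1 else 0) := by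
      by_cases hyr : y ≤ r <;> simp [hyr, hy0, indicator, mul_sub]
    rw [e]
    have hw : 0 ≤ c * r / (1 + c * r) := by positivity
    have s1 : c * r / (1 + c * r) * survivalMinorant n ε r y ≤
        c * r / (1 + c * r) * ((G - if y ≤ r then 1 else 0) / y) := by
      refine mul_le_mul_of_nonneg_left ?_ hw
      rw [le_div_iff₀ hy0, mul_comm]
      exact hkey
    refine s1.trans ?_
    have hk : k y = c * y / (1 + c * y) / y := by simp only [k]; field_simp
    rw [hk, div_mul_eq_mul_div (c * y / (1 + c * y)), ← mul_div_assoc]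
    refine div_le_div_of_nonneg_right ?_ hy0.le
    by_cases hyr : y ≤ r
    · simp only [hyr, if_true]
      refine mul_le_mul_of_nonpos_right ?_ (by linarith)
      rw [div_le_div_iff₀ (by positivity) (by positivity)]
      nlinarith [mul_le_mul_of_nonneg_left hyr hc]
    · simp only [hyr, if_false, sub_zero]
      refine mul_le_mul_of_nonneg_right ?_ hG0
      rw [div_le_div_iff₀ (by positivity) (by positivity)]
      nlinarith [mul_le_mul_of_nonneg_left (not_le.1 hyr).le hc]
  rw [integral_const_mul, hmi, integral_sub hG hI.integrableOn, ← hlog] at hle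
  have hw : 0 ≤ c * r / (1 + c * r) := by positivity
  have := mul_nonneg hw (show 0 ≤ -Real.log r - harmonic (n + 1) - ε / (n + 1) by linarith)
  linarith

end Integrals

/-- A nonnegative random variable with survival function `exp (-ε y) (1 + y) ^ (-(n + 2))`
satisfies `log (1 + c r) ≤ E log (1 + c Y)` as soon as `log r ≤ -H_{n+1} - ε / (n + 1)`. -/
theorem log_le_integral_log_of_survival {α : Type*} [MeasurableSpace α] {μ : Measure α}
    {Y : α → ℝ} (hY : AEMeasurable Y μ) (hY0 : 0 ≤ᵐ[μ] Y) (n : ℕ) {ε r c : ℝ} (hε : 0 ≤ ε)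
    (hr : 0 < r) (hc : 0 ≤ c) (h : Real.log r + harmonic (n + 1) + ε / (n + 1) ≤ 0)
    (hsurv : ∀ y, 0 < y → μ {ω | y < Y ω} =
      ENNReal.ofReal (Real.exp (-(ε * y)) * ((1 + y) ^ (n + 2))⁻¹)) :
    Integrable (fun ω => Real.log (1 + c * Y ω)) μ ∧
      Real.log (1 + c * r) ≤ ∫ ω, Real.log (1 + c * Y ω) ∂μ := by
  -- Layer-cake formula with `log (1 + c Y)` written as the integral of `c / (1 + c y)` from `0` to
  -- `Y`.
  have hlc := lintegral_comp_eq_lintegral_meas_lt_mul μ hY0 hY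
    (g := fun y => c / (1 + c * y))
    (fun t ht => ContinuousOn.intervalIntegrable (by
      refine ContinuousOn.div (by fun_prop) (by fun_prop) fun y hy => ?_
      rw [Set.uIcc_of_le ht.le] at hy
      have := hy.1
      positivity))
    ((ae_restrict_iff' measurableSet_Ioi).2 (Filter.Eventually.of_forall fun y hy => by
      have : 0 < y := hy
      positivity))
  have hl : ∫⁻ ω, ENNReal.ofReal (∫ t in (0 : ℝ)..Y ω, c / (1 + c * t)) ∂μ =
      ∫⁻ ω, ENNReal.ofReal (Real.log (1 + c * Y ω)) ∂μ := by
    refine lintegral_congr_ae ?_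
    filter_upwards [hY0] with ω hω
    rw [integral_rate_kernel hc hω]
  have hr' : ∫⁻ y in Set.Ioi 0, μ {a | y < Y a} * ENNReal.ofReal (c / (1 + c * y)) =
      ∫⁻ y in Set.Ioi 0, ENNReal.ofReal
        (c / (1 + c * y) * (Real.exp (-(ε * y)) * ((1 + y) ^ (n + 2))⁻¹)) := by
    refine setLIntegral_congr_fun measurableSet_Ioi fun y hy => ?_
    have hy0 : 0 < y := hy
    rw [hsurv y hy0, mul_comm, ← ENNReal.ofReal_mul (by positivity)]
  have hG := integrableOn_rate_survival n hε hc
  have hG0 : 0 ≤ᵐ[volume.restrict (Set.Ioi 0)] fun y : ℝ =>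
      c / (1 + c * y) * (Real.exp (-(ε * y)) * ((1 + y) ^ (n + 2))⁻¹) :=
    (ae_restrict_iff' measurableSet_Ioi).2 (Filter.Eventually.of_forall fun y hy => by
      have : 0 < y := hy
      simp only [Pi.zero_apply]
      positivity)
  rw [hl, hr', ← ofReal_integral_eq_lintegral_ofReal hG hG0] at hlc
  have hm : AEStronglyMeasurable (fun ω => Real.log (1 + c * Y ω)) μ :=
    (Real.measurable_log.comp_aemeasurable ((hY.const_mul c).const_add 1)).aestronglyMeasurable
  have hL0 : 0 ≤ᵐ[μ] fun ω => Real.log (1 + c * Y ω) := by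
    filter_upwards [hY0] with ω hω
    have : 0 ≤ Y ω := hω
    exact Real.log_nonneg (by nlinarith [mul_nonneg hc this])
  have hint : Integrable (fun ω => Real.log (1 + c * Y ω)) μ := by
    refine ⟨hm, ?_⟩
    rw [hasFiniteIntegral_iff_ofReal hL0, hlc]
    exact ENNReal.ofReal_lt_top
  refine ⟨hint, ?_⟩
  rw [integral_eq_lintegral_of_nonneg_ae hL0 hm, hlc,
    ENNReal.toReal_ofReal (integral_nonneg_of_ae hG0)]
  exact log_le_integral_rate_survival n hε hr hc h

/-! ### The complex Gaussian law and its exponential squared modulus. -/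

instance isProbabilityMeasure_complexGaussian : IsProbabilityMeasure complexGaussian := by
  unfold complexGaussian
  exact Measure.isProbabilityMeasure_map (MeasurableEquiv.measurable _).aemeasurable

theorem charFun_complexGaussian (t : ℂ) :
    charFun complexGaussian t = Complex.exp (-(‖t‖ : ℂ) ^ 2 / 4) := by
  have key : ∀ p : ℝ × ℝ, Complex.exp
      ((inner ℝ (Complex.measurableEquivRealProd.symm p) t : ℝ) * Complex.I) =
      Complex.exp ((inner ℝ p.1 t.re : ℝ) * Complex.I) *
        Complex.exp ((inner ℝ p.2 t.im : ℝ) * Complex.I) := by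
    intro p
    rw [← Complex.exp_add]
    congr 1
    simp only [Complex.inner, Complex.measurableEquivRealProd_symm_apply, Complex.mul_re,
      Complex.conj_re, Complex.conj_im, RCLike.inner_apply, conj_trivial]
    push_cast
    ring
  rw [charFun_apply, complexGaussian, integral_map_equiv]
  simp_rw [key]
  rw [integral_prod_mul (μ := gaussianReal 0 (1 / 2)) (ν := gaussianReal 0 (1 / 2))
    (fun x : ℝ => Complex.exp ((inner ℝ x t.re : ℝ) * Complex.I))
    (fun x : ℝ => Complex.exp ((inner ℝ x t.im : ℝ) * Complex.I)),
    ← charFun_apply, ← charFun_apply, charFun_gaussianReal, charFun_gaussianReal,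
    ← Complex.exp_add]
  congr 1
  have h : ((‖t‖ ^ 2 : ℝ) : ℂ) = (t.re : ℂ) ^ 2 + (t.im : ℂ) ^ 2 := by
    rw [← Complex.normSq_eq_norm_sq, Complex.normSq_apply]
    push_cast
    ring
  push_cast at h
  rw [h]
  push_cast
  ring

theorem integral_Ioi_two_mul_exp_neg_sq {a : ℝ} (ha : 0 ≤ a) :
    IntegrableOn (fun r : ℝ => 2 * r * Real.exp (-r ^ 2)) (Set.Ioi a) ∧
      ∫ r in Set.Ioi a, 2 * r * Real.exp (-r ^ 2) = Real.exp (-a ^ 2) := by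
  have hd : ∀ r ∈ Set.Ici a,
      HasDerivAt (fun r : ℝ => -Real.exp (-r ^ 2)) (2 * r * Real.exp (-r ^ 2)) r := by
    intro r _
    convert! (((hasDerivAt_id r).fun_pow 2).fun_neg.exp).neg using 1
    simp
    ring
  have hn : ∀ r ∈ Set.Ioi a, 0 ≤ 2 * r * Real.exp (-r ^ 2) := fun r hr => by
    have : 0 < r := ha.trans_lt hr
    positivity
  have ht : Filter.Tendsto (fun r : ℝ => -Real.exp (-r ^ 2)) Filter.atTop (nhds 0) := by
    have := (Real.tendsto_exp_neg_atTop_nhds_zero.comp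
      (Filter.tendsto_pow_atTop (α := ℝ) two_ne_zero)).neg
    simpa using this
  refine ⟨integrableOn_Ioi_deriv_of_nonneg' hd hn ht, ?_⟩
  rw [integral_Ioi_of_hasDerivAt_of_nonneg' hd hn ht]
  simp

theorem lintegral_complexGaussian {f : ℂ → ENNReal} (hf : Measurable f) :
    ∫⁻ z, f z ∂complexGaussian =
      ∫⁻ z, ENNReal.ofReal (Real.pi⁻¹ * Real.exp (-‖z‖ ^ 2)) * f z := by
  have hpdf : ∀ p : ℝ × ℝ, gaussianPDF 0 (1 / 2) p.1 * gaussianPDF 0 (1 / 2) p.2 =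
      ENNReal.ofReal
        (Real.pi⁻¹ * Real.exp (-‖Complex.measurableEquivRealProd.symm p‖ ^ 2)) := by
    intro p
    rw [gaussianPDF, gaussianPDF, ← ENNReal.ofReal_mul (gaussianPDFReal_nonneg _ _ _),
      gaussianPDFReal, gaussianPDFReal, mul_mul_mul_comm, ← Real.exp_add, ← mul_inv,
      Real.mul_self_sqrt (by positivity)]
    congr 2
    · congr 1
      push_cast
      ring
    · congr 1
      rw [← Complex.normSq_eq_norm_sq, Complex.normSq_apply]
      simp only [Complex.measurableEquivRealProd_symm_apply]
      push_cast
      ring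
  have hv : (1 / 2 : NNReal) ≠ 0 := by norm_num
  rw [complexGaussian, lintegral_map_equiv, gaussianReal_of_var_ne_zero 0 hv,
    prod_withDensity (measurable_gaussianPDF _ _) (measurable_gaussianPDF _ _),
    lintegral_withDensity_eq_lintegral_mul _ (by fun_prop) (by fun_prop),
    ← Complex.volume_preserving_equiv_real_prod.symm.lintegral_comp_emb
      (MeasurableEquiv.measurableEmbedding _), Measure.volume_eq_prod]
  refine lintegral_congr fun p => ?_
  simp only [Pi.mul_apply, hpdf]

theorem complexGaussian_norm_sq_gt {y : ℝ} (hy : 0 ≤ y) :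
    complexGaussian {z | y < ‖z‖ ^ 2} = ENNReal.ofReal (Real.exp (-y)) := by
  have hm : MeasurableSet {z : ℂ | y < ‖z‖ ^ 2} :=
    measurableSet_lt measurable_const (by fun_prop)
  rw [← lintegral_indicator_one hm, lintegral_complexGaussian (measurable_one.indicator hm),
    ← Complex.lintegral_comp_polarCoord_symm]
  -- The radial density `r / π` times `exp (-r²)` is split as `2 r exp (-r²)` times the uniform
  -- density `(2 π)⁻¹` of the angle.
  have h1 : ∫⁻ p in polarCoord.target, ENNReal.ofReal p.1 •
      (ENNReal.ofReal (Real.pi⁻¹ * Real.exp (-‖Complex.polarCoord.symm p‖ ^ 2)) *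
        {z : ℂ | y < ‖z‖ ^ 2}.indicator 1 (Complex.polarCoord.symm p)) =
      ∫⁻ p in Set.Ioi (0 : ℝ) ×ˢ Set.Ioo (-Real.pi) Real.pi,
        (Set.Ioi √y).indicator
          (fun r => ENNReal.ofReal (2 * r * Real.exp (-r ^ 2)) * ENNReal.ofReal (2 * Real.pi)⁻¹)
          p.1 := by
    rw [polarCoord_target]
    refine setLIntegral_congr_fun (measurableSet_Ioi.prod measurableSet_Ioo) fun p hp => ?_
    have hp0 : 0 < p.1 := hp.1
    have hn : ‖Complex.polarCoord.symm p‖ = p.1 := by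
      rw [Complex.norm_polarCoord_symm, abs_of_pos hp0]
    have hiff : p.1 ∈ Set.Ioi √y ↔ Complex.polarCoord.symm p ∈ {z : ℂ | y < ‖z‖ ^ 2} := by
      rw [Set.mem_Ioi, Set.mem_ofPred_eq, hn, Real.sqrt_lt' hp0]
    by_cases h : Complex.polarCoord.symm p ∈ {z : ℂ | y < ‖z‖ ^ 2}
    · simp only [Set.indicator_of_mem h, Set.indicator_of_mem (hiff.2 h), hn, Pi.one_apply,
        mul_one, smul_eq_mul]
      rw [← ENNReal.ofReal_mul hp0.le, ← ENNReal.ofReal_mul (by positivity)]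
      congr 1
      field_simp
    · simp only [Set.indicator_of_notMem h, Set.indicator_of_notMem (fun h' => h (hiff.1 h')),
        mul_zero, smul_zero]
  have hind : Measurable ((Set.Ioi √y).indicator fun r : ℝ =>
      ENNReal.ofReal (2 * r * Real.exp (-r ^ 2)) * ENNReal.ofReal (2 * Real.pi)⁻¹) :=
    (by fun_prop : Measurable _).indicator measurableSet_Ioi
  rw [h1, Measure.volume_eq_prod, ← Measure.prod_restrict,
    lintegral_prod (fun p : ℝ × ℝ => (Set.Ioi √y).indicator _ p.1)
      (hind.comp measurable_fst).aemeasurable]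
  simp only [lintegral_const, Measure.restrict_apply_univ, Real.volume_Ioo]
  rw [lintegral_mul_const _ hind, setLIntegral_indicator measurableSet_Ioi,
    Set.inter_eq_self_of_subset_left (Set.Ioi_subset_Ioi (Real.sqrt_nonneg y)),
    lintegral_mul_const _ (by fun_prop)]
  obtain ⟨hi, hv⟩ := integral_Ioi_two_mul_exp_neg_sq (Real.sqrt_nonneg y)
  rw [← ofReal_integral_eq_lintegral_ofReal hi, hv, Real.sq_sqrt hy, mul_assoc,
    ← ENNReal.ofReal_mul (by positivity)]
  · rw [show (2 * Real.pi)⁻¹ * (Real.pi - -Real.pi) = 1 by field_simp; ring]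
    simp
  · refine (ae_restrict_iff' measurableSet_Ioi).2 (Filter.Eventually.of_forall fun r hr => ?_)
    have : 0 < r := (Real.sqrt_nonneg y).trans_lt hr
    simp only [Pi.zero_apply]
    positivity

instance isProbabilityMeasure_expMeasure_one : IsProbabilityMeasure (expMeasure 1) :=
  isProbabilityMeasure_expMeasure one_pos

theorem expMeasure_one_Ioi {y : ℝ} (hy : 0 ≤ y) :
    expMeasure 1 (Set.Ioi y) = ENNReal.ofReal (Real.exp (-y)) := by
  have h := cdf_expMeasure_eq one_pos y
  rw [if_pos hy, cdf_eq_real] at h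
  rw [← Set.compl_Iic, ← ofReal_measureReal, probReal_compl_eq_one_sub measurableSet_Iic, h]
  simp

theorem expMeasure_one_Ioi_of_neg {y : ℝ} (hy : y < 0) : expMeasure 1 (Set.Ioi y) = 1 := by
  refine le_antisymm prob_le_one ?_
  calc (1 : ENNReal) = expMeasure 1 (Set.Ioi 0) := by simp [expMeasure_one_Ioi le_rfl]
    _ ≤ _ := measure_mono (Set.Ioi_subset_Ioi hy.le)

/-- The squared modulus of a `CN(0,1)` variable is exponential with mean one. -/
theorem map_norm_sq_complexGaussian : complexGaussian.map (fun z => ‖z‖ ^ 2) = expMeasure 1 := by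
  have hm : Measurable fun z : ℂ => ‖z‖ ^ 2 := by fun_prop
  have := Measure.isProbabilityMeasure_map (μ := complexGaussian) hm.aemeasurable
  refine Measure.ext_of_Iic _ _ fun y => ?_
  rw [← Set.compl_Ioi, prob_compl_eq_one_sub measurableSet_Ioi,
    prob_compl_eq_one_sub measurableSet_Ioi]
  congr 1
  rw [Measure.map_apply hm measurableSet_Ioi]
  rcases le_or_gt 0 y with hy | hy
  · rw [expMeasure_one_Ioi hy]
    exact complexGaussian_norm_sq_gt hy
  · rw [expMeasure_one_Ioi_of_neg hy]
    have : (fun z : ℂ => ‖z‖ ^ 2) ⁻¹' Set.Ioi y = Set.univ :=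
      Set.eq_univ_of_forall fun z => hy.trans_le (by positivity)
    rw [this, measure_univ]

/-- Atomlessness is the property of the entry law that makes the zero sets of nonzero polynomials
null, hence channel matrices invertible. -/
instance nullSingletonClass_complexGaussian : NullSingletonClass complexGaussian := by
  refine ⟨fun z => ?_⟩
  rw [← lintegral_indicator_one (measurableSet_singleton z),
    lintegral_complexGaussian (measurable_one.indicator (measurableSet_singleton z))]
  refine lintegral_eq_zero_of_ae_eq_zero ?_
  filter_upwards [(measure_eq_zero_iff_ae_notMem (μ := (volume : Measure ℂ))).1
    (measure_singleton z)] with w hw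
  simp [Set.indicator_of_notMem hw]

theorem aemeasurable_euclideanSpace {N : ℕ} {Ω : Type*} [MeasurableSpace Ω] {μ : Measure Ω}
    {X : Ω → EuclideanSpace ℂ (Fin N)}
    (hX : ∀ i, AEMeasurable (fun ω => X ω i) μ) : AEMeasurable X μ :=
  (MeasurableEquiv.toLp 2 (Fin N → ℂ)).measurable.comp_aemeasurable (aemeasurable_pi_lambda _ hX)

/-! ### Gains in a fixed or independent direction. -/

section GainLaw

variable {N : ℕ} {Ω : Type*} [MeasurableSpace Ω] {μ : Measure Ω} [IsProbabilityMeasure μ]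

/-- The inner product of a vector with i.i.d. `CN(0,1)` entries and a fixed unit vector is
`CN(0,1)`. -/
theorem map_inner_eq_complexGaussian {X : Ω → EuclideanSpace ℂ (Fin N)}
    (hlaw : ∀ i, HasLaw (fun ω => X ω i) complexGaussian μ)
    (hindep : iIndepFun (fun i ω => X ω i) μ) {u : EuclideanSpace ℂ (Fin N)} (hu : ‖u‖ = 1) :
    μ.map (fun ω => inner ℂ (X ω) u) = complexGaussian := by
  have hterm : ∀ i, Measurable fun z : ℂ => u i * (starRingEnd ℂ) z := fun i => by fun_prop
  have hsum : (fun ω => inner ℂ (X ω) u) = fun ω => ∑ i, u i * (starRingEnd ℂ) (X ω i) := by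
    funext ω
    simp [PiLp.inner_apply, RCLike.inner_apply]
  have hae : ∀ i, AEMeasurable (fun ω => u i * (starRingEnd ℂ) (X ω i)) μ := fun i =>
    (hterm i).comp_aemeasurable (hlaw i).aemeasurable
  have hind : iIndepFun (fun i ω => u i * (starRingEnd ℂ) (X ω i)) μ :=
    hindep.comp _ hterm
  rw [hsum]
  have := Measure.isProbabilityMeasure_map (μ := μ)
    (Finset.aemeasurable_fun_sum Finset.univ fun i _ => hae i)
  refine Measure.ext_of_charFun ?_
  rw [hind.charFun_map_fun_sum_eq_prod hae]
  funext t
  -- Each summand is `CN(0, |u i|²)`; in the product of characteristic functions the exponents add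
  -- up by `∑ |u i|² = 1`.
  have hcf : ∀ i, charFun (μ.map fun ω => u i * (starRingEnd ℂ) (X ω i)) t =
      Complex.exp (-((‖u i‖ : ℂ) * ‖t‖) ^ 2 / 4) := by
    intro i
    have h1 : μ.map (fun ω => u i * (starRingEnd ℂ) (X ω i)) =
        complexGaussian.map (fun z => u i * (starRingEnd ℂ) z) := by
      rw [← (hlaw i).map_eq, AEMeasurable.map_map_of_aemeasurable (hterm i).aemeasurable
        (hlaw i).aemeasurable]
      rfl
    have h2 : charFun (complexGaussian.map fun z => u i * (starRingEnd ℂ) z) t =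
        charFun complexGaussian (u i * (starRingEnd ℂ) t) := by
      rw [charFun_apply, charFun_apply, integral_map (hterm i).aemeasurable (by fun_prop)]
      congr 1
      funext z
      congr 3
      simp only [Complex.inner, Complex.mul_re, Complex.mul_im, Complex.conj_re, Complex.conj_im,
        map_mul]
      ring
    rw [h1, h2, charFun_complexGaussian]
    simp
  rw [Finset.prod_apply, Finset.prod_congr rfl fun i _ => hcf i, ← Complex.exp_sum,
    charFun_complexGaussian]
  congr 1
  have hn : ∑ i, ‖u i‖ ^ 2 = 1 := by
    rw [← EuclideanSpace.norm_sq_eq, hu, one_pow]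
  have hn' : ∑ i, (‖u i‖ : ℂ) ^ 2 = 1 := by exact_mod_cast hn
  simp only [mul_pow, neg_div, mul_div_assoc, Finset.sum_neg_distrib]
  rw [← Finset.sum_mul, hn', one_mul]

theorem measurable_gain : Measurable fun z : EuclideanSpace ℂ (Fin N) × EuclideanSpace ℂ (Fin N) =>
    gain z.1 z.2 := by
  unfold gain
  fun_prop

/-- The gain of a vector with i.i.d. `CN(0,1)` entries in an independent random direction is
exponential with mean one. -/
theorem map_gain_prod_eq_expMeasure {X : Ω → EuclideanSpace ℂ (Fin N)}
    (hlaw : ∀ i, HasLaw (fun ω => X ω i) complexGaussian μ)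
    (hindep : iIndepFun (fun i ω => X ω i) μ) {U : Ω → EuclideanSpace ℂ (Fin N)}
    (hU : AEMeasurable U μ) (hU1 : ∀ᵐ ω ∂μ, ‖U ω‖ = 1) :
    (((μ.map X).prod (μ.map U)).map fun z => gain z.1 z.2) = expMeasure 1 := by
  have hX : AEMeasurable X μ := aemeasurable_euclideanSpace fun i => (hlaw i).aemeasurable
  have := Measure.isProbabilityMeasure_map hX
  have := Measure.isProbabilityMeasure_map hU
  ext S hS
  rw [Measure.map_apply measurable_gain hS, Measure.prod_apply_symm (measurable_gain hS)]
  have hU1' : ∀ᵐ u ∂(μ.map U), ‖u‖ = 1 :=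
    (ae_map_iff hU (measurableSet_eq_fun measurable_norm measurable_const)).2 hU1
  -- Fubini with the direction frozen: the conditional law of the gain is the same for every unit
  -- vector `u`.
  have key : ∀ᵐ u ∂(μ.map U),
      μ.map X ((fun x => (x, u)) ⁻¹' ((fun z => gain z.1 z.2) ⁻¹' S)) = expMeasure 1 S := by
    filter_upwards [hU1'] with u hu
    have hmi : Measurable fun x : EuclideanSpace ℂ (Fin N) => inner ℂ x u := by fun_prop
    have hns : Measurable fun z : ℂ => ‖z‖ ^ 2 := by fun_prop
    have hXu : AEMeasurable (fun ω => inner ℂ (X ω) u) μ := hmi.comp_aemeasurable hX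
    rw [← map_norm_sq_complexGaussian, ← map_inner_eq_complexGaussian hlaw hindep hu,
      Measure.map_apply hns hS, Measure.map_apply_of_aemeasurable hX
        (measurable_prodMk_right (measurable_gain hS)),
      Measure.map_apply_of_aemeasurable hXu (hns hS)]
    rfl
  rw [lintegral_congr_ae key]
  simp

theorem map_gain_eq_expMeasure {X : Ω → EuclideanSpace ℂ (Fin N)}
    (hlaw : ∀ i, HasLaw (fun ω => X ω i) complexGaussian μ)
    (hindep : iIndepFun (fun i ω => X ω i) μ) {U : Ω → EuclideanSpace ℂ (Fin N)}
    (hU : AEMeasurable U μ) (hU1 : ∀ᵐ ω ∂μ, ‖U ω‖ = 1) (hXU : IndepFun X U μ) :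
    μ.map (fun ω => gain (X ω) (U ω)) = expMeasure 1 := by
  have hX : AEMeasurable X μ := aemeasurable_euclideanSpace fun i => (hlaw i).aemeasurable
  rw [← map_gain_prod_eq_expMeasure hlaw hindep hU hU1,
    ← (indepFun_iff_map_prod_eq_prod_map_map hX hU).1 hXU,
    AEMeasurable.map_map_of_aemeasurable measurable_gain.aemeasurable (hX.prodMk hU)]
  rfl

end GainLaw

/-! ### Almost sure invertibility of random matrices. -/

section PolynomialZeros

/-- The zero set of a nonzero polynomial is null for a power of an atomless measure. -/
theorem ae_eval_ne_zero_pi (ν : Measure ℂ) [IsProbabilityMeasure ν] [NullSingletonClass ν] (n : ℕ)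
    {p : MvPolynomial (Fin n) ℂ} (hp : p ≠ 0) :
    ∀ᵐ x ∂Measure.pi fun _ : Fin n => ν, MvPolynomial.eval x p ≠ 0 := by
  induction n with
  | zero =>
    refine Filter.Eventually.of_forall fun x => ?_
    rw [MvPolynomial.eq_C_of_isEmpty p] at hp ⊢
    simpa using hp
  | succ n ih =>
    set q := MvPolynomial.finSuccEquiv ℂ n p with hq
    have hq0 : q ≠ 0 := by simpa [hq] using hp
    have hlc := ih (Polynomial.leadingCoeff_ne_zero.2 hq0)
    let S : Set (ℂ × (Fin n → ℂ)) :=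
      {z | MvPolynomial.eval (Fin.cons z.1 z.2 : Fin (n + 1) → ℂ) p = 0}
    have hcons : Continuous fun z : ℂ × (Fin n → ℂ) => (Fin.cons z.1 z.2 : Fin (n + 1) → ℂ) :=
      continuous_pi fun i => by
        refine Fin.cases ?_ (fun j => ?_) i
        · simpa using continuous_fst
        · simp only [Fin.cons_succ]
          fun_prop
    have hS : MeasurableSet S :=
      (isClosed_eq ((MvPolynomial.continuous_eval p).comp hcons) continuous_const).measurableSet
    have hS0 : (ν.prod (Measure.pi fun _ : Fin n => ν)) S = 0 := by
      -- As a polynomial in the first variable, `p` has a leading coefficient that is almost surely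
      -- nonzero in the other variables by induction. For such values only finitely many roots
      -- remain, a null set for an atomless measure.
      rw [Measure.prod_apply_symm hS]
      refine lintegral_eq_zero_of_ae_eq_zero ?_
      filter_upwards [hlc] with y hy
      have hne : q.map (MvPolynomial.eval y) ≠ 0 := fun h0 => hy (by
        have := congrArg (fun r => Polynomial.coeff r q.natDegree) h0
        simpa [Polynomial.coeff_map] using this)
      refine measure_mono_null (fun x hx => ?_)
        ((q.map (MvPolynomial.eval y)).roots.toFinset.finite_toSet.measure_zero ν)
      have hx' : MvPolynomial.eval (Fin.cons x y : Fin (n + 1) → ℂ) p = 0 := hx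
      rw [MvPolynomial.eval_eq_eval_mv_eval'] at hx'
      simpa [hne] using hx'
    have hmp := measurePreserving_piFinSuccAbove (fun _ : Fin (n + 1) => ν) 0
    rw [← hmp.measure_preimage hS.nullMeasurableSet] at hS0
    rw [ae_iff]
    refine measure_mono_null (fun x hx => ?_) hS0
    have hx' : MvPolynomial.eval x p = 0 := by simpa using hx
    change MvPolynomial.eval (Fin.cons (x 0) fun j => x ((0 : Fin (n + 1)).succAbove j)) p = 0
    convert hx'
    refine funext fun i => Fin.cases ?_ (fun j => ?_) i <;> simp

/-- A square matrix with i.i.d. entries of atomless law is almost surely invertible. -/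
theorem ae_det_ne_zero_of_iid {Ω : Type*} [MeasurableSpace Ω] {μ : Measure Ω}
    [IsProbabilityMeasure μ] {ν : Measure ℂ} [IsProbabilityMeasure ν] [NullSingletonClass ν] {n : ℕ}
    {X : Fin n × Fin n → Ω → ℂ} (hlaw : ∀ q, HasLaw (X q) ν μ) (hindep : iIndepFun X μ) :
    ∀ᵐ ω ∂μ, (Matrix.of fun i j => X (i, j) ω).det ≠ 0 := by
  let σ : Fin (n * n) ≃ Fin n × Fin n := finProdFinEquiv.symm
  -- The determinant of the generic matrix is a nonzero polynomial; its variables are renumbered by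
  -- `Fin (n * n)` to fit the induction.
  have hp : MvPolynomial.rename σ.symm (Matrix.mvPolynomialX (Fin n) (Fin n) ℂ).det ≠ 0 := by
    rw [Ne, map_eq_zero_iff _ (MvPolynomial.rename_injective _ σ.symm.injective)]
    exact Matrix.det_mvPolynomialX_ne_zero _ _
  have hm : ∀ r, AEMeasurable (X (σ r)) μ := fun r => (hlaw _).aemeasurable
  have hjoint := (iIndepFun_iff_map_fun_eq_pi_map hm).1 (hindep.precomp σ.injective)
  simp_rw [(hlaw _).map_eq] at hjoint
  have hae := ae_eval_ne_zero_pi ν (n * n) hp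
  rw [← hjoint] at hae
  filter_upwards [ae_of_ae_map (aemeasurable_pi_lambda _ hm) hae] with ω hω
  rw [MvPolynomial.eval_rename] at hω
  have he : (fun r => X (σ r) ω) ∘ σ.symm = fun q => X q ω := by
    funext q
    simp
  rwa [he, Matrix.eval_det_mvPolynomialX] at hω

end PolynomialZeros

/-! ### Zero-forcing directions as cofactor vectors. -/

section ZeroForcing

variable {N : ℕ}

/-- A column of cofactors of the matrix with rows `(x b)ᴴ`: it is orthogonal to all `x b` with
`b ≠ a`, and does not depend on `x a`. -/
noncomputable def zfDirection (x : Fin N → EuclideanSpace ℂ (Fin N)) (a : Fin N) :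
    EuclideanSpace ℂ (Fin N) :=
  WithLp.toLp 2 fun i =>
    ((Matrix.of fun b l => (starRingEnd ℂ) (x b l)).updateRow a (Pi.single i 1)).det

theorem zfDirection_congr {x y : Fin N → EuclideanSpace ℂ (Fin N)} {a : Fin N}
    (h : ∀ b, b ≠ a → x b = y b) : zfDirection x a = zfDirection y a := by
  ext i
  simp only [zfDirection]
  congr 1
  ext b l
  by_cases hb : b = a
  · simp [hb]
  · simp [Matrix.updateRow_ne hb, h b hb]

theorem continuous_zfDirection (a : Fin N) :
    Continuous fun x : Fin N → EuclideanSpace ℂ (Fin N) => zfDirection x a := by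
  unfold zfDirection
  refine (PiLp.continuous_toLp 2 _).comp (continuous_pi fun i => Continuous.matrix_det ?_)
  refine Continuous.matrix_updateRow _ (continuous_matrix fun b l => ?_) continuous_const
  simp only [Matrix.of_apply]
  fun_prop

/-- Orthogonality says that `A p` is a multiple of the basis vector `e_a`. Multiplying by the
adjugate gives `det A • p` as a multiple of column `a` of the adjugate, which is `zfDirection x a`.
-/
theorem exists_eq_smul_zfDirection {x : Fin N → EuclideanSpace ℂ (Fin N)} {a : Fin N}
    (hdet : (Matrix.of fun b l => x b l).det ≠ 0) {p : EuclideanSpace ℂ (Fin N)}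
    (hp : ∀ b, b ≠ a → inner ℂ (x b) p = 0) : ∃ c : ℂ, p = c • zfDirection x a := by
  set A : Matrix (Fin N) (Fin N) ℂ := Matrix.of fun b l => (starRingEnd ℂ) (x b l) with hA
  have hAdet : A.det ≠ 0 := by
    have h1 : A = (starRingEnd ℂ).mapMatrix (Matrix.of fun b l => x b l) := by
      ext b l
      simp [hA]
    rw [h1, ← RingHom.map_det]
    simpa using hdet
  have hAp : A.mulVec p = Pi.single a (inner ℂ (x a) p) := by
    have h1 : ∀ b, A.mulVec p b = inner ℂ (x b) p := fun b => by
      simp [Matrix.mulVec, dotProduct, hA, PiLp.inner_apply, RCLike.inner_apply, mul_comm]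
    funext b
    rw [h1]
    by_cases hb : b = a
    · subst hb
      simp
    · rw [hp b hb, Pi.single_eq_of_ne hb]
  have hadj : A.det • (p : Fin N → ℂ) = A.adjugate.mulVec (Pi.single a (inner ℂ (x a) p)) := by
    rw [← hAp, Matrix.mulVec_mulVec, Matrix.adjugate_mul, Matrix.smul_mulVec, Matrix.one_mulVec]
  refine ⟨A.det⁻¹ * inner ℂ (x a) p, ?_⟩
  ext i
  have hi := congrFun hadj i
  rw [Matrix.mulVec_single, Pi.smul_apply] at hi
  simp only [Pi.smul_apply, Matrix.col_apply, Matrix.adjugate_apply, smul_eq_mul,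
    MulOpposite.smul_eq_mul_unop, MulOpposite.unop_op] at hi
  simp only [PiLp.smul_apply, smul_eq_mul, zfDirection]
  rw [← hA, mul_assoc, mul_comm (inner ℂ (x a) p), ← hi, inv_mul_cancel_left₀ hAdet]

theorem gain_smul (c : ℂ) (x u : EuclideanSpace ℂ (Fin N)) : gain x (c • u) = ‖c‖ ^ 2 * gain x u := by
  simp only [gain, inner_smul_right, norm_mul, mul_pow]

/-- The normalised `zfDirection`. -/
noncomputable def zfUnit (x : Fin N → EuclideanSpace ℂ (Fin N)) (a : Fin N) :
    EuclideanSpace ℂ (Fin N) :=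
  ((‖zfDirection x a‖⁻¹ : ℝ) : ℂ) • zfDirection x a

theorem measurable_zfUnit (a : Fin N) :
    Measurable fun x : Fin N → EuclideanSpace ℂ (Fin N) => zfUnit x a := by
  have h := (continuous_zfDirection a).measurable
  exact (Complex.measurable_ofReal.comp h.norm.inv).smul h

/-- Given invertibility, a zero-forcing unit vector has the gains of `zfUnit`. -/
theorem zfUnit_spec {x : Fin N → EuclideanSpace ℂ (Fin N)} {a : Fin N}
    (hdet : (Matrix.of fun b l => x b l).det ≠ 0) {p : EuclideanSpace ℂ (Fin N)} (hp1 : ‖p‖ = 1)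
    (hp : ∀ b, b ≠ a → inner ℂ (x b) p = 0) :
    ‖zfUnit x a‖ = 1 ∧ ∀ y, gain y p = gain y (zfUnit x a) := by
  obtain ⟨c, hc⟩ := exists_eq_smul_zfDirection hdet hp
  -- Hence `p` and `zfUnit x a` differ only by a phase, to which the gain is blind.
  have hn : ‖c‖ * ‖zfDirection x a‖ = 1 := by rw [← norm_smul, ← hc, hp1]
  have hw : ‖zfDirection x a‖ ≠ 0 := right_ne_zero_of_mul_eq_one hn
  refine ⟨?_, fun y => ?_⟩
  · rw [zfUnit, norm_smul, Complex.norm_real, norm_inv, norm_norm, inv_mul_cancel₀ hw]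
  · rw [hc, zfUnit, gain_smul, gain_smul, Complex.norm_real, norm_inv, norm_norm,
      eq_inv_of_mul_eq_one_left hn]

end ZeroForcing

/-! ### Laws of the private gains. -/

section ZeroForcingGains

variable {N K : ℕ} {Ω : Type*} [MeasurableSpace Ω] {μ : Measure Ω}
  {G₁ : Finset (Fin K)} {h : Fin K → Ω → EuclideanSpace ℂ (Fin N)}
  {p : G₁ → Ω → EuclideanSpace ℂ (Fin N)}

theorem IsRayleighChannel.iIndepFun_apply (hh : IsRayleighChannel h μ) (k : Fin K) :
    iIndepFun (fun i ω => h k ω i) μ :=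
  hh.indep.precomp (g := fun i : Fin N => (k, i)) fun _ _ hij => (Prod.mk.inj hij).2

theorem IsRayleighChannel.aemeasurable (hh : IsRayleighChannel h μ) (k : Fin K) :
    AEMeasurable (h k) μ :=
  aemeasurable_euclideanSpace fun i => (hh.hasLaw k i).aemeasurable

/-- A measurable function of the other channels is independent of the channel of user `k`. -/
theorem IsRayleighChannel.indepFun_zfUnit (hh : IsRayleighChannel h μ) (e : Fin N → Fin K)
    (a : Fin N) (k : Fin K) (hk : ∀ b, b ≠ a → e b ≠ k) :
    IndepFun (h k) (fun ω => zfUnit (fun b => if b = a then 0 else h (e b) ω) a) μ := by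
  classical
  let S : Finset (Fin K × Fin N) := Finset.univ.filter fun q => q.1 = k
  let T : Finset (Fin K × Fin N) := Finset.univ.filter fun q => q.1 ≠ k
  have hST : Disjoint S T := Finset.disjoint_filter_filter_not _ _ _
  have hind := hh.indep.indepFun_finset₀ S T hST fun q => (hh.hasLaw q.1 q.2).aemeasurable
  let φ : (S → ℂ) → EuclideanSpace ℂ (Fin N) := fun f =>
    WithLp.toLp 2 fun i => f ⟨(k, i), by simp [S]⟩
  let ψ : (T → ℂ) → EuclideanSpace ℂ (Fin N) := fun f =>
    zfUnit (fun b => if hb : b = a then 0 else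
      WithLp.toLp 2 fun i => f ⟨(e b, i), by simp [T, hk b hb]⟩) a
  have hφ : Measurable φ := (MeasurableEquiv.toLp 2 (Fin N → ℂ)).measurable.comp
    (measurable_pi_lambda _ fun i => measurable_pi_apply _)
  have hψ : Measurable ψ := (measurable_zfUnit a).comp (measurable_pi_lambda _ fun b => by
    by_cases hb : b = a
    · simp [hb]
    · simp only [hb, dite_false]
      exact (MeasurableEquiv.toLp 2 (Fin N → ℂ)).measurable.comp
        (measurable_pi_lambda _ fun i => measurable_pi_apply _))
  exact hind.comp hφ hψ

variable [IsProbabilityMeasure μ]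

/-- A private gain that is not forced to zero is exponential with mean one. -/
theorem IsZFPrecoder.map_gain_eq_expMeasure (hp : IsZFPrecoder G₁ h p μ) (hG₁ : G₁.card = N)
    (hh : IsRayleighChannel h μ) (k : Fin K) (j : G₁) (hkj : k ∈ G₁ → k = j) :
    μ.map (fun ω => gain (h k ω) (p j ω)) = expMeasure 1 := by
  classical
  let e : Fin N ≃ G₁ := (G₁.equivFinOfCardEq hG₁).symm
  let a : Fin N := e.symm j
  have hdet : ∀ᵐ ω ∂μ, (Matrix.of fun b l => h (e b) ω l).det ≠ 0 := by
    refine ae_det_ne_zero_of_iid (ν := complexGaussian)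
      (X := fun q : Fin N × Fin N => fun ω => h (e q.1) ω q.2) (fun q => hh.hasLaw _ _) ?_
    refine hh.indep.precomp (g := fun q : Fin N × Fin N => ((e q.1 : Fin K), q.2)) ?_
    rintro ⟨b, l⟩ ⟨b', l'⟩ hq
    simpa [Prod.ext_iff, Subtype.ext_iff.symm] using hq
  -- Zeroing slot `a` makes it visible that `U` does not involve the channel of user `j`; the
  -- direction is unchanged because row `a` is overwritten in `zfDirection`.
  let U : Ω → EuclideanSpace ℂ (Fin N) := fun ω =>
    zfUnit (fun b => if b = a then 0 else h (e b) ω) a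
  have hU : AEMeasurable U μ :=
    (measurable_zfUnit a).comp_aemeasurable (aemeasurable_pi_lambda _ fun b => by
      by_cases hb : b = a
      · simp [hb]
      · simpa [hb] using hh.aemeasurable _)
  have hspec : ∀ᵐ ω ∂μ, ‖U ω‖ = 1 ∧ gain (h k ω) (p j ω) = gain (h k ω) (U ω) := by
    filter_upwards [hdet, hp.zero_forcing, (hp.isPrecoder j).norm_eq_one] with ω h1 h2 h3
    have hUω : U ω = zfUnit (fun b => h (e b) ω) a := by
      simp only [U, zfUnit]
      rw [zfDirection_congr (y := fun b => h (e b) ω) fun b hb => by simp [hb]]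
    rw [hUω]
    have := zfUnit_spec (a := a) h1 h3 fun b hb => h2 (e b) j fun hbj => hb (by
      simp [a, ← hbj])
    exact ⟨this.1, this.2 _⟩
  have hind : IndepFun (h k) U μ := by
    -- A user `k` in `G₁` must be `j`, whose slot is `a`; a user outside `G₁` occupies no slot.
    refine hh.indepFun_zfUnit (fun b => e b) a k fun b hb hbk => hb ?_
    have : e b = j := Subtype.ext (hbk.trans (hkj (hbk ▸ (e b).2)))
    simp [a, ← this]
  rw [Measure.map_congr (hspec.mono fun ω hω => hω.2)]
  exact _root_.map_gain_eq_expMeasure (hh.hasLaw k) (hh.iIndepFun_apply k) hU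
    (hspec.mono fun ω hω => hω.1) hind

/-- The other private gains vanish. -/
theorem IsZFPrecoder.map_gain_eq_dirac (hp : IsZFPrecoder G₁ h p μ) (k : Fin K) (j : G₁)
    (hk : k ∈ G₁) (hkj : k ≠ j) :
    μ.map (fun ω => gain (h k ω) (p j ω)) = Measure.dirac 0 := by
  have hz : (fun ω => gain (h k ω) (p j ω)) =ᵐ[μ] fun _ => 0 := by
    filter_upwards [hp.zero_forcing] with ω hω
    have := hω ⟨k, hk⟩ j fun h' => hkj (congrArg Subtype.val h')
    simp [gain, this]
  rw [Measure.map_congr hz, Measure.map_const, measure_univ, one_smul]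

end ZeroForcingGains

/-! ### Laplace transforms of product and exponential laws. -/

theorem lintegral_prod_eq_prod_lintegral_pi {ι : Type*} [Fintype ι] {E : ι → Type*}
    [∀ i, MeasurableSpace (E i)] (μ : ∀ i, Measure (E i)) [∀ i, IsProbabilityMeasure (μ i)]
    {f : ∀ i, E i → ENNReal} (hf : ∀ i, Measurable (f i)) :
    ∫⁻ x, ∏ i, f i (x i) ∂Measure.pi μ = ∏ i, ∫⁻ x, f i x ∂μ i := by
  have hind := iIndepFun_pi (μ := μ) (X := f) fun i => (hf i).aemeasurable
  have h := lintegral_prod_eq_prod_lintegral_of_indepFun Finset.univ _ hind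
    fun i => (hf i).comp (measurable_pi_apply i)
  rw [h]
  exact Finset.prod_congr rfl fun i _ => (measurePreserving_eval μ i).lintegral_comp (hf i)

/-- Exponential tilting: the integrand times the density is `(1 + y)⁻¹` times the density of rate `1
+ y`, which has total mass one. -/
theorem lintegral_exp_neg_mul_expMeasure_one {y : ℝ} (hy : 0 ≤ y) :
    ∫⁻ b, ENNReal.ofReal (Real.exp (-(y * b))) ∂expMeasure 1 = ENNReal.ofReal (1 + y)⁻¹ := by
  have hy1 : 0 < 1 + y := by positivity
  have hpt : ∀ b : ℝ, exponentialPDF 1 b * ENNReal.ofReal (Real.exp (-(y * b))) =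
      ENNReal.ofReal (1 + y)⁻¹ * exponentialPDF (1 + y) b := by
    intro b
    rw [exponentialPDF_eq, exponentialPDF_eq]
    split_ifs
    · rw [← ENNReal.ofReal_mul (by positivity), ← ENNReal.ofReal_mul (by positivity), one_mul,
        ← Real.exp_add, inv_mul_cancel_left₀ hy1.ne']
      congr 2
      ring
    · simp
  have hpdf : expMeasure 1 = volume.withDensity (exponentialPDF 1) := rfl
  have hm : ∀ r, Measurable (exponentialPDF r) := fun r =>
    (measurable_exponentialPDFReal r).ennreal_ofReal
  rw [hpdf, lintegral_withDensity_eq_lintegral_mul _ (hm 1) (by fun_prop)]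
  simp only [Pi.mul_apply, hpt]
  rw [lintegral_const_mul _ (hm _), lintegral_exponentialPDF_eq_one hy1, mul_one]

theorem ae_nonneg_expMeasure_one : ∀ᵐ x ∂expMeasure 1, 0 ≤ x := by
  have h : expMeasure 1 (Set.Ioi 0)ᶜ = 0 := by
    rw [prob_compl_eq_zero_iff measurableSet_Ioi, expMeasure_one_Ioi le_rfl]
    simp
  have h' : ∀ᵐ x ∂expMeasure 1, x ∈ Set.Ioi (0 : ℝ) := h
  exact h'.mono fun x hx => le_of_lt hx

/-! ### The survival function of the normalised minimum SINR. -/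

section Survival

variable {K : ℕ} (G₁ : Finset (Fin K))

/-- The law of the private gain of user `k` from the precoder of user `j`. -/
noncomputable def privateGainLaw (k : Fin K) (j : G₁) : Measure ℝ :=
  if k ∈ G₁ → k = j then expMeasure 1 else Measure.dirac 0

instance isProbabilityMeasure_privateGainLaw (k : Fin K) (j : G₁) :
    IsProbabilityMeasure (privateGainLaw G₁ k j) := by
  unfold privateGainLaw
  split_ifs <;> infer_instance

/-- The explicit law of the gains under the independence approximation. -/
noncomputable def gainLaw : Measure ((Fin K → ℝ) × (Fin K → G₁ → ℝ)) :=
  (Measure.pi fun _ => expMeasure 1).prod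
    (Measure.pi fun k => Measure.pi fun j => privateGainLaw G₁ k j)

theorem ae_nonneg_privateGainLaw (k : Fin K) (j : G₁) : ∀ᵐ x ∂privateGainLaw G₁ k j, 0 ≤ x := by
  unfold privateGainLaw
  split_ifs
  · exact ae_nonneg_expMeasure_one
  · rw [ae_dirac_iff measurableSet_Ici]

theorem lintegral_exp_neg_mul_privateGainLaw (k : Fin K) (j : G₁) {y : ℝ} (hy : 0 ≤ y) :
    ∫⁻ b, ENNReal.ofReal (Real.exp (-(y * b))) ∂privateGainLaw G₁ k j =
      if k ∈ G₁ → k = j then ENNReal.ofReal (1 + y)⁻¹ else 1 := by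
  unfold privateGainLaw
  split_ifs
  · exact lintegral_exp_neg_mul_expMeasure_one hy
  · rw [lintegral_dirac]
    simp

theorem ae_private_nonneg :
    ∀ᵐ b ∂Measure.pi fun k => Measure.pi fun j => privateGainLaw G₁ k j, ∀ k j, 0 ≤ b k j := by
  rw [ae_all_iff]
  intro k
  rw [ae_all_iff]
  intro j
  have h1 : ∀ᵐ x ∂Measure.pi fun j => privateGainLaw G₁ k j, 0 ≤ x j :=
    Measure.tendsto_eval_ae_ae.eventually (ae_nonneg_privateGainLaw G₁ k j)
  exact (Measure.quasiMeasurePreserving_eval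
    (fun k => Measure.pi fun j => privateGainLaw G₁ k j) k).ae h1

theorem ae_gainLaw_nonneg :
    ∀ᵐ g ∂gainLaw G₁, (∀ k, 0 ≤ g.1 k) ∧ ∀ k j, 0 ≤ g.2 k j := by
  have h1 : ∀ᵐ a ∂Measure.pi fun _ : Fin K => expMeasure 1, ∀ k, 0 ≤ a k := by
    rw [ae_all_iff]
    exact fun k => Measure.tendsto_eval_ae_ae.eventually ae_nonneg_expMeasure_one
  exact (Measure.quasiMeasurePreserving_fst.ae h1).and
    (Measure.quasiMeasurePreserving_snd.ae (ae_private_nonneg G₁))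

/-- Counts the nonvanishing private gains: a user of `G₁` receives only its own stream, any other
user receives all `|G₁|` of them. -/
theorem prod_laplace_eq (x : ENNReal) :
    ∏ k : Fin K, ∏ j : G₁, (if k ∈ G₁ → k = j then x else 1) =
      x ^ (G₁.card + (K - G₁.card) * G₁.card) := by
  classical
  have hk : ∀ k : Fin K, ∏ j : G₁, (if k ∈ G₁ → k = j then x else 1) =
      if k ∈ G₁ then x else x ^ G₁.card := by
    intro k
    split_ifs with h
    · rw [Finset.prod_eq_single ⟨k, h⟩]
      · simp
      · intro j _ hj
        rw [if_neg fun h' => hj (Subtype.ext (h' h).symm)]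
      · simp
    · simp [h]
  simp_rw [hk]
  rw [Finset.prod_ite, Finset.prod_const, Finset.prod_const, ← pow_mul, ← pow_add]
  congr 1
  have h1 : (Finset.univ.filter fun k => k ∈ G₁) = G₁ := by ext; simp
  have h2 : (Finset.univ.filter fun k => k ∉ G₁) = G₁ᶜ := by ext; simp
  rw [h1, h2, Finset.card_compl, Fintype.card_fin]
  ring

/-- The tail of the minimum: the joint probability of `y (d k + ∑ j, b k j) < a k` for all `k`. -/
theorem gainLaw_forall_lt (d : Fin K → ℝ) (hd : ∀ k, 0 ≤ d k) {y : ℝ} (hy : 0 ≤ y) :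
    gainLaw G₁ {g | ∀ k, y * (d k + ∑ j, g.2 k j) < g.1 k} =
      ENNReal.ofReal (Real.exp (-((∑ k, d k) * y)) *
        ((1 + y) ^ (G₁.card + (K - G₁.card) * G₁.card))⁻¹) := by
  have hS : MeasurableSet {g : (Fin K → ℝ) × (Fin K → G₁ → ℝ) |
      ∀ k, y * (d k + ∑ j, g.2 k j) < g.1 k} := by
    rw [Set.ofPred_forall]
    exact MeasurableSet.iInter fun k => measurableSet_lt (by fun_prop) (by fun_prop)
  rw [gainLaw, Measure.prod_apply_symm hS]
  -- For frozen private gains the exponential tails of the common gains multiply. The exponential of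
  -- the sum then splits, leaving one Laplace transform per private gain.
  have hae : ∀ᵐ b ∂Measure.pi fun k => Measure.pi fun j => privateGainLaw G₁ k j,
      (Measure.pi fun _ : Fin K => expMeasure 1)
        ((fun a => (a, b)) ⁻¹' {g : (Fin K → ℝ) × (Fin K → G₁ → ℝ) | ∀ k, y * (d k + ∑ j, g.2 k j) < g.1 k}) =
      ∏ k, (ENNReal.ofReal (Real.exp (-(d k * y))) *
        ∏ j, ENNReal.ofReal (Real.exp (-(y * b k j)))) := by
    filter_upwards [ae_private_nonneg G₁] with b hb
    have hset : (fun a => (a, b)) ⁻¹' {g : (Fin K → ℝ) × (Fin K → G₁ → ℝ) | ∀ k, y * (d k + ∑ j, g.2 k j) < g.1 k} =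
        Set.univ.pi fun k => Set.Ioi (y * (d k + ∑ j, b k j)) := by
      ext a
      simp
    rw [hset, Measure.pi_pi]
    refine Finset.prod_congr rfl fun k _ => ?_
    rw [expMeasure_one_Ioi (mul_nonneg hy (add_nonneg (hd k)
      (Finset.sum_nonneg fun j _ => hb k j))), ← ENNReal.ofReal_prod_of_nonneg fun j _ =>
      (Real.exp_pos _).le, ← ENNReal.ofReal_mul (Real.exp_pos _).le, ← Real.exp_sum,
      ← Real.exp_add, Finset.sum_neg_distrib, ← Finset.mul_sum]
    congr 2
    ring
  have hmj : ∀ _ : G₁, Measurable fun b : ℝ => ENNReal.ofReal (Real.exp (-(y * b))) :=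
    fun _ => by fun_prop
  rw [lintegral_congr_ae hae, lintegral_prod_eq_prod_lintegral_pi
    (f := fun (k : Fin K) (b : G₁ → ℝ) => ENNReal.ofReal (Real.exp (-(d k * y))) *
        ∏ j, ENNReal.ofReal (Real.exp (-(y * b j)))) _ (fun k => by fun_prop)]
  have hk : ∀ k, ∫⁻ b, (ENNReal.ofReal (Real.exp (-(d k * y))) *
        ∏ j : G₁, ENNReal.ofReal (Real.exp (-(y * b j))))
          ∂(Measure.pi fun j => privateGainLaw G₁ k j) =
      ENNReal.ofReal (Real.exp (-(d k * y))) *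
        ∏ j : G₁, if k ∈ G₁ → k = j then ENNReal.ofReal (1 + y)⁻¹ else 1 := by
    intro k
    rw [lintegral_const_mul _ (by fun_prop), lintegral_prod_eq_prod_lintegral_pi _ hmj]
    simp_rw [lintegral_exp_neg_mul_privateGainLaw G₁ k _ hy]
  simp_rw [hk]
  rw [Finset.prod_mul_distrib, prod_laplace_eq, ← ENNReal.ofReal_prod_of_nonneg fun k _ =>
    (Real.exp_pos _).le, ← ENNReal.ofReal_pow (by positivity),
    ← ENNReal.ofReal_mul (Finset.prod_nonneg fun k _ => (Real.exp_pos _).le), ← Real.exp_sum,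
    Finset.sum_neg_distrib, ← Finset.sum_mul, inv_pow]

/-- The minimum over the users of the SINRs, normalised. -/
noncomputable def normalizedMinSINR (d : Fin K → ℝ) (g : (Fin K → ℝ) × (Fin K → G₁ → ℝ)) : ℝ :=
  ⨅ k, g.1 k / (d k + ∑ j, g.2 k j)

theorem measurable_normalizedMinSINR (d : Fin K → ℝ) : Measurable (normalizedMinSINR G₁ d) :=
  Measurable.iInf fun k => by fun_prop

theorem normalizedMinSINR_nonneg {d : Fin K → ℝ} (hd : ∀ k, 0 < d k) :
    0 ≤ᵐ[gainLaw G₁] normalizedMinSINR G₁ d := by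
  filter_upwards [ae_gainLaw_nonneg G₁] with g hg
  exact Real.iInf_nonneg fun k => div_nonneg (hg.1 k)
    (add_nonneg (hd k).le (Finset.sum_nonneg fun j _ => hg.2 k j))

/-- Strict inequalities pass to the infimum because a minimum over finitely many users is attained.
Nonemptiness excludes the default value `0` of an empty infimum. -/
theorem gainLaw_lt_normalizedMinSINR [Nonempty (Fin K)] {d : Fin K → ℝ} (hd : ∀ k, 0 < d k)
    {y : ℝ} (hy : 0 ≤ y) :
    gainLaw G₁ {g | y < normalizedMinSINR G₁ d g} =
      ENNReal.ofReal (Real.exp (-((∑ k, d k) * y)) *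
        ((1 + y) ^ (G₁.card + (K - G₁.card) * G₁.card))⁻¹) := by
  rw [← gainLaw_forall_lt G₁ d (fun k => (hd k).le) hy]
  refine measure_congr ?_
  filter_upwards [ae_gainLaw_nonneg G₁] with g hg
  refine propext ?_
  change y < normalizedMinSINR G₁ d g ↔ ∀ k, y * (d k + ∑ j, g.2 k j) < g.1 k
  have hpos : ∀ k, 0 < d k + ∑ j, g.2 k j := fun k =>
    add_pos_of_pos_of_nonneg (hd k) (Finset.sum_nonneg fun j _ => hg.2 k j)
  have hbdd : BddBelow (Set.range fun k => g.1 k / (d k + ∑ j, g.2 k j)) :=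
    (Set.finite_range _).bddBelow
  constructor
  · intro h k
    rw [← lt_div_iff₀ (hpos k)]
    exact h.trans_le (ciInf_le hbdd k)
  · intro h
    obtain ⟨k, hk⟩ := exists_eq_ciInf_of_finite (f := fun k => g.1 k / (d k + ∑ j, g.2 k j))
    rw [normalizedMinSINR, ← hk, lt_div_iff₀ (hpos k)]
    exact h k

/-- Dividing numerator and denominator of each SINR by `P t v_k / N` leaves the factor `N (1 - t) /
t`, common to all users; it is nonnegative because `t ≤ 1` and so comes out of the infimum. -/
theorem commonRate_eq (N : ℕ) (hN : 0 < N) (v : Fin K → ℝ) (hv : ∀ k, 0 < v k) {P t : ℝ}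
    (ht : 0 < t) (ht1 : t ≤ 1) (hP : 0 < P * t) (g : (Fin K → ℝ) × (Fin K → G₁ → ℝ)) :
    commonRate N G₁ v P t g = Real.log (1 + N * (1 - t) / t *
      normalizedMinSINR G₁ (fun k => N / (P * t * v k)) g) / Real.log 2 := by
  have hN' : (0 : ℝ) < N := Nat.cast_pos.2 hN
  have hP' : 0 < P := pos_of_mul_pos_left hP ht.le
  have hc : 0 ≤ N * (1 - t) / t := div_nonneg (mul_nonneg hN'.le (by linarith)) ht.le
  rw [commonRate, Real.logb, normalizedMinSINR, Real.mul_iInf_of_nonneg hc]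
  congr 3
  refine iInf_congr fun k => ?_
  have hvk := hv k
  have hden : 1 + P * t / N * v k * ∑ j, g.2 k j =
      P * t * v k / N * (N / (P * t * v k) + ∑ j, g.2 k j) := by
    field_simp
  rw [commonSINR, hden, ← div_div]
  rw [← mul_div_assoc]
  congr 1
  field_simp

end Survival

/-! ### Assembly of the rate bound. -/

theorem approxGainLaw_eq_gainLaw {N K : ℕ} {Ω : Type*} [MeasurableSpace Ω] {μ : Measure Ω}
    [IsProbabilityMeasure μ] {G₁ : Finset (Fin K)} (hG₁ : G₁.card = N)
    {h : Fin K → Ω → EuclideanSpace ℂ (Fin N)} (hh : IsRayleighChannel h μ)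
    {pc : Ω → EuclideanSpace ℂ (Fin N)} (hpc : IsPrecoder pc μ)
    {p : G₁ → Ω → EuclideanSpace ℂ (Fin N)} (hp : IsZFPrecoder G₁ h p μ) :
    approxGainLaw G₁ h pc p μ = gainLaw G₁ := by
  have h1 : ∀ k, (((μ.map (h k)).prod (μ.map pc)).map fun z => gain z.1 z.2) = expMeasure 1 :=
    fun k => map_gain_prod_eq_expMeasure (hh.hasLaw k) (hh.iIndepFun_apply k) hpc.aemeasurable
      hpc.norm_eq_one
  have h2 : ∀ k j, (μ.map fun ω => gain (h k ω) (p j ω)) = privateGainLaw G₁ k j := by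
    intro k j
    unfold privateGainLaw
    split_ifs with hkj
    · exact hp.map_gain_eq_expMeasure hG₁ hh k j hkj
    · push Not at hkj
      exact hp.map_gain_eq_dirac k j hkj.1 hkj.2
  simp_rw [approxGainLaw, h1, h2, gainLaw]

/-- The number `N (K - N + 1)` is already an integer, so the rounding has no effect, and `n + 1` is
the `M - 1` of the constant. -/
theorem rhoZF_eq {N K n : ℕ} (hNK : N < K) (hn : N + (K - N) * N = n + 2) :
    rhoZF N K = N * (1 / ((n : ℝ) + 1) *
      Real.exp (-Real.eulerMascheroniConstant - 1 / (2 * ((n : ℝ) + 1)))) := by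
  have h : (N : ℝ) * ((K : ℝ) - N + 1) = ((n + 2 : ℕ) : ℝ) := by
    rw [← hn]
    push_cast [Nat.cast_sub hNK.le]
    ring
  have h1 : ((n : ℝ) + 2 - 1) = n + 1 := by ring
  rw [rhoZF, h, round_natCast]
  push_cast
  rw [h1]
  ring

theorem proposition2 {N K : ℕ} (hN : 0 < N) (hNK : N < K)
    {Ω : Type*} [MeasurableSpace Ω] (μ : Measure Ω) [IsProbabilityMeasure μ]
    (G₁ : Finset (Fin K)) (hG₁ : G₁.card = N)
    (v : Fin K → ℝ) (hv : ∀ k, 0 < v k ∧ v k ≤ 1)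
    (h : Fin K → Ω → EuclideanSpace ℂ (Fin N)) (hh : IsRayleighChannel h μ)
    (pc : Ω → EuclideanSpace ℂ (Fin N)) (hpc : IsPrecoder pc μ)
    (p : G₁ → Ω → EuclideanSpace ℂ (Fin N)) (hp : IsZFPrecoder G₁ h p μ) :
    ∃ s₀ : ℝ, 0 < s₀ ∧ ∀ P t : ℝ, 0 < t → t ≤ 1 → s₀ ≤ P * t →
      Integrable (commonRate N G₁ v P t) (approxGainLaw G₁ h pc p μ) ∧
      Real.logb 2 (1 - rhoZF N K + rhoZF N K / t) ≤ approxCommonRate G₁ v P t h pc p μ := by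
  have : Nonempty (Fin K) := ⟨⟨0, by omega⟩⟩
  -- The exponent is at least `2 N ≥ 2` because `K > N`.
  obtain ⟨n, hn⟩ : ∃ n, N + (K - N) * N = n + 2 := by
    have : N ≤ (K - N) * N := Nat.le_mul_of_pos_left N (by omega)
    exact ⟨N + (K - N) * N - 2, by omega⟩
  set r : ℝ := 1 / ((n : ℝ) + 1) *
    Real.exp (-Real.eulerMascheroniConstant - 1 / (2 * ((n : ℝ) + 1))) with hr
  have hn1 : (0 : ℝ) < n + 1 := by positivity
  have hr0 : 0 < r := by positivity
  have hlogr : Real.log r = -Real.log (n + 1) - Real.eulerMascheroniConstant -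
      1 / (2 * ((n : ℝ) + 1)) := by
    rw [hr, Real.log_mul (by positivity) (Real.exp_pos _).ne', Real.log_exp, one_div, Real.log_inv]
    ring
  -- The slack in the harmonic bound, positive by strictness; it is the budget for the noise.
  set δ : ℝ := -(Real.log r + harmonic (n + 1)) with hδ
  have hδ0 : 0 < δ := by
    have := harmonic_succ_lt n
    rw [hδ, hlogr]
    linarith
  set V : ℝ := ∑ k, N / v k with hV
  have hV0 : 0 ≤ V := Finset.sum_nonneg fun k _ => div_nonneg (Nat.cast_nonneg N) (hv k).1.le
  -- From `P t ≥ V / δ` follows `ε = V / (P t) ≤ δ`; the added `1` keeps the threshold positive even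
  -- if `V / δ` is only known to be nonnegative.
  refine ⟨V / δ + 1, by positivity, fun P t ht ht1 hs => ?_⟩
  have hPt : 0 < P * t := lt_of_lt_of_le (by positivity) hs
  have hd : ∀ k, 0 < (N : ℝ) / (P * t * v k) := fun k => by
    have := (hv k).1
    positivity
  have hε : ∑ k, (N : ℝ) / (P * t * v k) = V / (P * t) := by
    rw [hV, Finset.sum_div]
    refine Finset.sum_congr rfl fun k _ => ?_
    rw [div_div, mul_comm (v k)]
  have hεδ : V / (P * t) ≤ δ := by
    rw [div_le_iff₀ hPt, ← div_le_iff₀' hδ0]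
    linarith
  have hε0 : 0 ≤ V / (P * t) := by positivity
  have hcond : Real.log r + harmonic (n + 1) + V / (P * t) / (n + 1) ≤ 0 := by
    have h1 : V / (P * t) / ((n : ℝ) + 1) ≤ V / (P * t) :=
      div_le_self hε0 (by linarith [Nat.cast_nonneg (α := ℝ) n])
    linarith
  have hc : (0 : ℝ) ≤ N * (1 - t) / t :=
    div_nonneg (mul_nonneg (Nat.cast_nonneg N) (by linarith)) ht.le
  obtain ⟨hint, hle⟩ := log_le_integral_log_of_survival (μ := gainLaw G₁)
    (measurable_normalizedMinSINR G₁ fun k => N / (P * t * v k)).aemeasurable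
    (normalizedMinSINR_nonneg G₁ hd) n hε0 hr0 hc hcond fun y hy => by
      rw [gainLaw_lt_normalizedMinSINR G₁ hd hy.le, hε, hG₁, hn]
  have hrate : commonRate N G₁ v P t = fun g => Real.log (1 + N * (1 - t) / t *
      normalizedMinSINR G₁ (fun k => N / (P * t * v k)) g) / Real.log 2 :=
    funext fun g => commonRate_eq G₁ N hN v (fun k => (hv k).1) ht ht1 hPt g
  rw [approxCommonRate, approxGainLaw_eq_gainLaw hG₁ hh hpc hp, hrate, integral_div]
  refine ⟨hint.div_const _, ?_⟩
  rw [Real.logb, rhoZF_eq hNK hn, ← hr]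
  refine div_le_div_of_nonneg_right ?_ (Real.log_nonneg one_le_two)
  -- With `ρ = N r` and `c = N (1 - t) / t`, both arguments agree: `1 - ρ + ρ / t = 1 + c r`.
  refine le_trans (le_of_eq ?_) hle
  congr 1
  field_simp
  ring
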